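/- **Main Theorem.** Let $X$ be a nonempty compact Hausdorff space of weight at most $\aleph_1$ (that is, the least cardinality of a base for the topology of $X$ is at most $\aleph_1$), and let $f\colon X\to X$ be continuous. Let $\omega^*=\beta\omega\setminus\omega$ be the space of free ultrafilters on $\omega$, with the subspace topology from $\beta\omega$, and let $\sigma\colon\omega^*\to\omega^*$ be the shift map, which sends $p$ to the ultrafilter generated by $\{A+1 : A\in p\}$. Then the following are equivalent: 1. $(X,f)$ is a quotient of $(\omega^*,\sigma)$, i.e. there is a continuous surjection $Q\colon\omega^*\to X$ with $Q\circ\sigma=f\circ Q$; 2. $f$ is weakly incompressible, i.e. for every open $U\subseteq X$ with $\emptyset\neq U\neq X$ we have $f(\overline{U})\not\subseteq U$. -/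

import Mathlib

open Topology Cardinal

universe u v

namespace OmegaStar

/-- `ω* = βω \ ω`: the free (nonprincipal) ultrafilters on `ω = ℕ`, with the subspace topology
inherited from the space `Ultrafilter ℕ = βω` of all ultrafilters on `ℕ`. -/
abbrev Remainder : Type := {p : Ultrafilter ℕ // p ∉ Set.range (pure : ℕ → Ultrafilter ℕ)}

/-- The shift map on `βω`: `p` goes to the ultrafilter generated by `{A + 1 : A ∈ p}`. -/
def shiftBeta (p : Ultrafilter ℕ) : Ultrafilter ℕ := p.map (fun n => n + 1)

theorem shiftBeta_free {p : Ultrafilter ℕ} (hp : p ∉ Set.range (pure : ℕ → Ultrafilter ℕ)) :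
    shiftBeta p ∉ Set.range (pure : ℕ → Ultrafilter ℕ) := by
  rintro ⟨n, hn⟩
  have h1 : ({n} : Set ℕ) ∈ shiftBeta p := by
    rw [← hn]
    exact Set.mem_singleton n
  have h2 : (fun k : ℕ => k + 1) ⁻¹' {n} ∈ p := h1
  have h3 : ((fun k : ℕ => k + 1) ⁻¹' {n}).Finite :=
    (Set.finite_singleton n).preimage (add_left_injective 1).injOn
  obtain ⟨x, -, hx⟩ := Ultrafilter.eq_pure_of_finite_mem h3 h2
  exact hp ⟨x, hx.symm⟩

/-- The shift map `σ` on `ω*`. -/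
def shift (p : Remainder) : Remainder := ⟨shiftBeta p.1, shiftBeta_free p.2⟩

/-- `(Y, g)` is a quotient of `(X, f)`: there is a continuous surjection `Q : X → Y` with
`Q ∘ f = g ∘ Q`. -/
def IsQuotientOf {Y : Type u} {X : Type v} [TopologicalSpace Y] [TopologicalSpace X]
    (g : Y → Y) (f : X → X) : Prop :=
  ∃ Q : X → Y, Continuous Q ∧ Function.Surjective Q ∧ Q ∘ f = g ∘ Q

/-- `f` is weakly incompressible: `f (closure U) ⊈ U` for every open `U` with `∅ ≠ U ≠ X`. -/
def WeaklyIncompressible {X : Type u} [TopologicalSpace X] (f : X → X) : Prop :=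
  ∀ U : Set X, IsOpen U → U ≠ ∅ → U ≠ Set.univ → ¬ f '' closure U ⊆ U

/-- The weight of a topological space: the least cardinality of a base of its topology. -/
noncomputable def weight (X : Type u) [TopologicalSpace X] : Cardinal.{u} :=
  sInf {κ : Cardinal.{u} | ∃ B : Set (Set X), TopologicalSpace.IsTopologicalBasis B ∧ #B = κ}

end OmegaStar

/-! Index a base of `X` by `ι` with `#ι ≤ ℵ₁`. A finite `K : Finset ι` cuts `X` into finitely many
cells; one cell has an edge to another when `f` maps some point of the closure of the first into the
closure of the second. Weak incompressibility makes every such graph strongly connected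
(`transGen_edge_of_weaklyIncompressible`). A quotient map can be read off from one family `h : ι →
Set ℕ` that is a trace for all `K` at once: edges give equivariance, visits give surjectivity
(`isQuotientOf_of_isTrace`).

For countably many indices, finite paths are concatenated. For `ℵ₁` indices the trace is built along
a well-order with countable initial segments, so a trace on a set `S` must be extended without being
changed. This works when `S` is elementary: finite pieces of the new index set have copies inside
`S`, and the trace there supplies walks through the new cells. `IsElementary.exists_crossing` makes
consecutive walks meet infinitely often, so that they can be spliced
(`IsElementary.exists_extension`).

Conversely, a clopen subset of `ω*` that the shift maps into itself comes from a set of integers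
almost closed under successor, so it is empty or everything. -/

namespace OmegaStar

open Filter

/-! ### Cells, finite copies and traces -/

section Traces

variable {X : Type u} {ι : Type v}

/-- The points that lie in the same members of the family `U i`, `i ∈ K`, as `x`. -/
def cell (U : ι → Set X) (K : Finset ι) (x : X) : Set X := {y | ∀ i ∈ K, y ∈ U i ↔ x ∈ U i}

/-- The graph that a relation `E` between sets induces on the `K`-cells. -/
def Edge (U : ι → Set X) (E : Set X → Set X → Prop) (K : Finset ι) (x y : X) : Prop :=
  E (cell U K x) (cell U K y)

/-- `U ∘ τ` and `U` realize the same patterns on `K`, and edges for `U ∘ τ` are edges for `U`. -/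
structure IsCopy (U : ι → Set X) (E : Set X → Set X → Prop) (K : Finset ι) (τ : ι → ι) :
    Prop where
  forth : ∀ x, ∃ x', ∀ i ∈ K, x' ∈ U (τ i) ↔ x ∈ U i
  back : ∀ x', ∃ x, ∀ i ∈ K, x' ∈ U (τ i) ↔ x ∈ U i
  edge : ∀ x y x' y', (∀ i ∈ K, x' ∈ U (τ i) ↔ x ∈ U i) → (∀ i ∈ K, y' ∈ U (τ i) ↔ y ∈ U i) →
    Edge (U ∘ τ) E K x' y' → Edge U E K x y

/-- Every finite set of indices has a copy inside `S` over any finite subset of `S`. -/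
def IsElementary [DecidableEq ι] (U : ι → Set X) (E : Set X → Set X → Prop) (S : Set ι) : Prop :=
  ∀ F K : Finset ι, (F : Set ι) ⊆ S →
    ∃ τ : ι → ι, (∀ i ∈ F, τ i = i) ∧ (∀ i ∈ K, τ i ∈ S) ∧ IsCopy U E (F ∪ K) τ

/-- The sets `h i` describe a walk in the graph of `K`-cells that visits every cell infinitely
often. -/
structure IsTrace (U : ι → Set X) (E : Set X → Set X → Prop) (h : ι → Set ℕ) (K : Finset ι) :
    Prop where
  walk : ∃ y : ℕ → X, ∀ᶠ k in atTop,
    (∀ i ∈ K, k ∈ h i ↔ y k ∈ U i) ∧ Edge U E K (y k) (y (k + 1))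
  visit : ∀ x, ∃ᶠ k in atTop, ∀ i ∈ K, k ∈ h i ↔ x ∈ U i

variable {U : ι → Set X} {E : Set X → Set X → Prop}

theorem cell_eq_of_mem {K : Finset ι} {x y : X} (h : y ∈ cell U K x) :
    cell U K y = cell U K x := by
  ext z
  exact forall₂_congr fun i hi => by rw [h i hi]

theorem mem_cell_self (K : Finset ι) (x : X) : x ∈ cell U K x := fun _ _ => Iff.rfl

theorem cell_anti {K L : Finset ι} (h : K ⊆ L) (x : X) : cell U L x ⊆ cell U K x :=
  fun _ hy i hi => hy i (h hi)

theorem cell_image [DecidableEq ι] (K : Finset ι) (τ : ι → ι) (x : X) :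
    cell U (K.image τ) x = cell (U ∘ τ) K x := by
  ext z
  simp [cell]

theorem exists_finset_forall_mem_cell (U : ι → Set X) (K : Finset ι) :
    ∃ D : Finset X, ∀ x, ∃ d ∈ D, d ∈ cell U K x := by
  classical
  have hfin : (Set.range fun x => K.filter fun i => x ∈ U i).Finite :=
    K.powerset.finite_toSet.subset (by
      rintro _ ⟨x, rfl⟩
      exact Finset.mem_coe.2 (Finset.mem_powerset.2 (Finset.filter_subset _ _)))
  obtain ⟨D, -, hD⟩ := Set.exists_subset_bijOn Set.univ (fun x => K.filter fun i => x ∈ U i)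
  rw [Set.image_univ] at hD
  have hDf : D.Finite := Set.Finite.of_finite_image (hD.image_eq ▸ hfin) hD.injOn
  refine ⟨hDf.toFinset, fun x => ?_⟩
  obtain ⟨d, hd, hdx⟩ := hD.surjOn ⟨x, rfl⟩
  refine ⟨d, by simpa using hd, fun i hi => ?_⟩
  have := Finset.ext_iff.1 hdx i
  simpa [hi] using this

theorem Edge.anti (hE : ∀ a b a' b', a ⊆ a' → b ⊆ b' → E a b → E a' b') {K L : Finset ι}
    (h : K ⊆ L) {x y : X} (hxy : Edge U E L x y) : Edge U E K x y :=
  hE _ _ _ _ (cell_anti h x) (cell_anti h y) hxy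

theorem IsTrace.image [DecidableEq ι] {h : ι → Set ℕ} {K : Finset ι} {τ : ι → ι}
    (hh : IsTrace U E h (K.image τ)) : IsTrace (U ∘ τ) E (h ∘ τ) K := by
  obtain ⟨⟨y, hy⟩, hv⟩ := hh
  constructor
  · refine ⟨y, hy.mono fun k hk => ?_⟩
    simpa [Edge, cell_image] using hk
  · simpa using hv

/-- Iterating the choice of a copy and using that there are finitely many patterns gives a copy
that some point does not distinguish from the original. -/
theorem IsElementary.exists_crossing [DecidableEq ι] [Nonempty X] {S : Set ι}
    (hS : IsElementary U E S) (F K : Finset ι) (hF : (F : Set ι) ⊆ S) :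
    ∃ (M : Finset ι) (τ : ι → ι), F ∪ K ⊆ M ∧ (∀ i ∈ F, τ i = i) ∧ (∀ i ∈ M, τ i ∈ S) ∧
      IsCopy U E M τ ∧ ∃ x, ∀ i ∈ K, x ∈ U (τ i) ↔ x ∈ U i := by
  classical
  let step (G : {G : Finset ι // (G : Set ι) ⊆ S}) := hS G.1 K G.2
  choose τ hfix hmem hcopy using step
  -- The copy of `K` just chosen joins the set that later copies must fix.
  let next (G : {G : Finset ι // (G : Set ι) ⊆ S}) : {G : Finset ι // (G : Set ι) ⊆ S} :=
    ⟨G.1 ∪ K.image (τ G), by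
      rintro i hi
      rcases Finset.mem_union.1 (Finset.mem_coe.1 hi) with hi | hi
      · exact G.2 hi
      · obtain ⟨j, hj, rfl⟩ := Finset.mem_image.1 hi
        exact hmem G j hj⟩
  let G : ℕ → {G : Finset ι // (G : Set ι) ⊆ S} := fun n => next^[n] ⟨F, hF⟩
  have hGsucc : ∀ n, G (n + 1) = next (G n) := fun n => Function.iterate_succ_apply' next n _
  have hGmono : Monotone fun n => (G n).1 := monotone_nat_of_le_succ fun n => by
    rw [hGsucc]
    exact Finset.subset_union_left
  obtain ⟨x₀⟩ := ‹Nonempty X›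
  -- Pigeonhole: the copies of `K` cut out only finitely many patterns at the fixed point `x₀`.
  obtain ⟨m, n, hmn, heq⟩ : ∃ m n, m < n ∧
      (K.filter fun i => x₀ ∈ U (τ (G m) i)) = K.filter fun i => x₀ ∈ U (τ (G n) i) := by
    have : Set.MapsTo (fun n => K.filter fun i => x₀ ∈ U (τ (G n) i)) Set.univ
        (K.powerset : Set (Finset ι)) := fun n _ => by
      exact Finset.mem_coe.2 (Finset.mem_powerset.2 (Finset.filter_subset _ _))
    obtain ⟨m, -, n, -, hmn, heq⟩ :=
      Set.infinite_univ.exists_ne_map_eq_of_mapsTo this K.powerset.finite_toSet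
    rcases lt_or_gt_of_ne hmn with h | h
    · exact ⟨m, n, h, heq⟩
    · exact ⟨n, m, h, heq.symm⟩
  have hsub : ∀ n, F ⊆ (G n).1 := fun n => hGmono (Nat.zero_le n)
  -- For `i ∈ K` the later copy fixes `τ (G m) i`, so `x ∈ U (τ (G m) i)` iff `x₀` is there, while
  -- `x ∈ U i` iff `x₀ ∈ U (τ (G n) i)`; `heq` equates the two.
  obtain ⟨x, hx⟩ := (hcopy (G n)).back x₀
  refine ⟨(G m).1 ∪ K, τ (G m), Finset.union_subset_union_left (hsub m),
    fun i hi => hfix _ i (hsub m hi), fun i hi => ?_, hcopy _, x, fun i hi => ?_⟩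
  · rcases Finset.mem_union.1 hi with hi | hi
    · rw [hfix _ _ hi]
      exact (G m).2 hi
    · exact hmem _ i hi
  · have h1 : τ (G m) i ∈ (G n).1 := hGmono (Nat.succ_le_of_lt hmn) (by
      simp only [Nat.succ_eq_add_one, hGsucc]
      exact Finset.mem_union_right _ (Finset.mem_image_of_mem _ hi))
    have h2 := hx _ (Finset.mem_union_left K h1)
    rw [hfix _ _ h1] at h2
    have h3 := Finset.ext_iff.1 heq i
    simp only [Finset.mem_filter, hi, true_and] at h3
    rw [← h2, h3, hx i (Finset.mem_union_right _ hi)]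

end Traces

/-! ### Splicing walks and extending traces -/

section Splicing

variable {X : Type u} {ι : Type v} {U : ι → Set X} {E : Set X → Set X → Prop}

theorem eventually_exists_block {t : ℕ → ℕ} (ht : StrictMono t) (n : ℕ) :
    ∀ᶠ k in atTop, ∃ j, n ≤ j ∧ t j ≤ k ∧ k < t (j + 1) := by
  filter_upwards [eventually_ge_atTop (t n)] with k hk
  have hn : n ≤ k := ht.le_apply.trans hk
  refine ⟨Nat.findGreatest (fun j => t j ≤ k) k, Nat.le_findGreatest hn hk,
    Nat.findGreatest_spec (P := fun j => t j ≤ k) hn hk, ?_⟩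
  by_contra! h
  have h1 := Nat.le_findGreatest (P := fun j => t j ≤ k) (ht.le_apply.trans h) h
  omega

/-- Walks at successive levels, each one starting in the cell where the previous one stops, are
spliced together. -/
theorem exists_spliced {t : ℕ → ℕ} (ht : StrictMono t) (K : ℕ → Finset ι) (z : ℕ → ℕ → X)
    (hedge : ∀ j k, t j ≤ k → k < t (j + 1) → Edge U E (K j) (z j k) (z j (k + 1)))
    (hjoin : ∀ j, z (j + 1) (t (j + 1)) ∈ cell U (K j) (z j (t (j + 1)))) :
    ∃ y : ℕ → X, (∀ j k, t j ≤ k → k < t (j + 1) → y k = z j k) ∧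
      ∀ j k, t j ≤ k → k < t (j + 1) → Edge U E (K j) (y k) (y (k + 1)) := by
  have key : ∀ j k, t j ≤ k → k < t (j + 1) → Nat.findGreatest (fun j => t j ≤ k) k = j := by
    intro j k h1 h2
    refine Nat.findGreatest_eq_iff.2 ⟨ht.le_apply.trans h1, fun _ => h1, fun n hn _ h => ?_⟩
    exact absurd ((ht.monotone (Nat.succ_le_of_lt hn)).trans h) (not_le.2 h2)
  have hy : ∀ j k, t j ≤ k → k < t (j + 1) →
      z (Nat.findGreatest (fun j => t j ≤ k) k) k = z j k := fun j k h1 h2 => by rw [key j k h1 h2]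
  refine ⟨fun k => z (Nat.findGreatest (fun j => t j ≤ k) k) k, hy, fun j k h1 h2 => ?_⟩
  have h3 := hedge j k h1 h2
  simp only [hy j k h1 h2]
  -- At the last step of a block the target already belongs to walk `j + 1`; `hjoin` puts it in the
  -- same `K j`-cell, so the edge survives.
  rcases (Nat.succ_le_of_lt h2).lt_or_eq with h | h
  · rwa [hy j (k + 1) (h1.trans k.le_succ) h]
  · have h' : k + 1 = t (j + 1) := h
    rw [hy (j + 1) (k + 1) h'.ge (h' ▸ ht (Nat.lt_succ_self _))]
    have h4 := hjoin j
    rw [← h'] at h4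
    rwa [Edge, cell_eq_of_mem h4]

theorem exists_exhaustion {T : Set ι} (hT : T.Countable) :
    ∃ K : ℕ → Finset ι, Monotone K ∧ (∀ n, (K n : Set ι) ⊆ T) ∧ ∀ i ∈ T, ∃ n, i ∈ K n := by
  obtain ⟨f, hf⟩ := Set.countable_iff_exists_injOn.1 hT
  have hfin : ∀ n, (T ∩ f ⁻¹' Set.Iic n).Finite := fun n =>
    Set.Finite.of_finite_image ((Set.finite_Iic n).subset (by
      rintro _ ⟨i, hi, rfl⟩
      exact hi.2)) (hf.mono Set.inter_subset_left)
  refine ⟨fun n => (hfin n).toFinset, fun m n hmn i => ?_, fun n => ?_, fun i hi => ⟨f i, ?_⟩⟩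
  · simp only [Set.Finite.mem_toFinset]
    exact fun h => ⟨h.1, h.2.trans hmn⟩
  · simp
  · simp [hi]

theorem exists_le_of_subset {K : ℕ → Finset ι} (hK : Monotone K) {T : Set ι}
    (hT : ∀ i ∈ T, ∃ n, i ∈ K n) (F : Finset ι) (hF : (F : Set ι) ⊆ T) : ∃ n, F ⊆ K n := by
  classical
  induction F using Finset.induction_on with
  | empty => exact ⟨0, Finset.empty_subset _⟩
  | insert i F _ ih =>
    rw [Finset.coe_insert, Set.insert_subset_iff] at hF
    obtain ⟨m, hm⟩ := ih hF.2
    obtain ⟨n, hn⟩ := hT i hF.1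
    exact ⟨max m n, Finset.insert_subset (hK (le_max_right m n) hn)
      (hm.trans (hK (le_max_left m n)))⟩

theorem eventually_forall_visited {z : ℕ → X} {K : Finset ι}
    (hz : ∀ x, ∃ᶠ k in atTop, z k ∈ cell U K x) (s : ℕ) :
    ∀ᶠ t in atTop, ∀ x, ∃ k, s ≤ k ∧ k < t ∧ z k ∈ cell U K x := by
  obtain ⟨D, hD⟩ := exists_finset_forall_mem_cell U K
  have : ∀ d ∈ D, ∀ᶠ t in atTop, ∃ k, s ≤ k ∧ k < t ∧ z k ∈ cell U K d := fun d _ => by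
    obtain ⟨k, hk, hzk⟩ := frequently_atTop.1 (hz d) s
    filter_upwards [eventually_gt_atTop k] with t ht
    exact ⟨k, hk, ht, hzk⟩
  filter_upwards [(eventually_all_finset D).2 this] with t ht x
  obtain ⟨d, hd, hdx⟩ := hD x
  obtain ⟨k, h1, h2, h3⟩ := ht d hd
  exact ⟨k, h1, h2, cell_eq_of_mem hdx ▸ h3⟩

/-- Infinite walks at increasing levels that cross infinitely often are spliced into one walk. -/
theorem exists_spliced_of_crossing (hE : ∀ a b a' b', a ⊆ a' → b ⊆ b' → E a b → E a' b')
    {K : ℕ → Finset ι} (hK : Monotone K) (z : ℕ → ℕ → X) (P : ℕ → ℕ → Prop)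
    (hP : ∀ n, ∀ᶠ k in atTop, P n k)
    (hedge : ∀ n, ∀ᶠ k in atTop, Edge U E (K n) (z n k) (z n (k + 1)))
    (hvisit : ∀ n x, ∃ᶠ k in atTop, z n k ∈ cell U (K n) x)
    (hcross : ∀ n, ∃ᶠ k in atTop, z (n + 1) k ∈ cell U (K n) (z n k)) :
    ∃ y : ℕ → X, (∀ n, ∀ᶠ k in atTop, Edge U E (K n) (y k) (y (k + 1))) ∧
      (∀ n x, ∃ᶠ k in atTop, y k ∈ cell U (K n) x) ∧
      ∀ n, ∀ᶠ k in atTop, ∃ j, n ≤ j ∧ y k = z j k ∧ P j k := by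
  -- The switching time is a crossing late enough that walk `n` has visited all its cells since `s`
  -- and walk `n + 1` is good from then on.
  have hnext : ∀ n s, ∃ s', s < s' ∧ (∀ x, ∃ k, s ≤ k ∧ k < s' ∧ z n k ∈ cell U (K n) x) ∧
      z (n + 1) s' ∈ cell U (K n) (z n s') ∧
      ∀ k, s' ≤ k → P (n + 1) k ∧ Edge U E (K (n + 1)) (z (n + 1) k) (z (n + 1) (k + 1)) := by
    intro n s
    have h := (hcross n).and_eventually ((eventually_gt_atTop s).and
      ((eventually_forall_visited (hvisit n) s).and
        (eventually_forall_ge_atTop.2 ((hP (n + 1)).and (hedge (n + 1))))))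
    obtain ⟨s', h1, h2, h3, h4⟩ := h.exists
    exact ⟨s', h2, h3, h1, h4⟩
  choose next hlt hvis hjoin hgood using hnext
  obtain ⟨t₀, ht₀⟩ := eventually_atTop.1 ((hP 0).and (hedge 0))
  let t : ℕ → ℕ := fun n => Nat.rec t₀ next n
  have ht : StrictMono t := strictMono_nat_of_lt_succ fun n => hlt n (t n)
  have hgood' : ∀ n k, t n ≤ k → P n k ∧ Edge U E (K n) (z n k) (z n (k + 1)) := by
    intro n
    cases n with
    | zero => exact ht₀
    | succ n => exact hgood n (t n)
  obtain ⟨y, hyz, hy⟩ := exists_spliced ht K z (fun j k h _ => (hgood' j k h).2)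
    (fun j => hjoin j (t j))
  refine ⟨y, fun n => ?_, fun n x => ?_, fun n => ?_⟩
  · filter_upwards [eventually_exists_block ht n] with k hk
    obtain ⟨j, hj, h1, h2⟩ := hk
    exact (hy j k h1 h2).anti hE (hK hj)
  · refine frequently_atTop.2 fun a => ?_
    obtain ⟨k, h1, h2, h3⟩ := hvis (max a n) (t (max a n)) x
    refine ⟨k, (le_max_left a n).trans (ht.le_apply.trans h1), ?_⟩
    rw [hyz _ k h1 h2]
    exact cell_anti (hK (le_max_right a n)) x h3
  · filter_upwards [eventually_exists_block ht n] with k hk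
    obtain ⟨j, hj, h1, h2⟩ := hk
    exact ⟨j, hj, hyz j k h1 h2, (hgood' j k h1).1⟩

/-- Exhaust `T` by finite sets `K n`. A copy moves `K n` into `S`, fixing `K n ∩ S` and all indices
used before; the trace on `S` then yields a walk through the `K n`-cells that is compatible with `h`
on `K n ∩ S`. -/
theorem IsElementary.exists_extension [DecidableEq ι] [Nonempty X]
    (hE : ∀ a b a' b', a ⊆ a' → b ⊆ b' → E a b → E a' b') {S T : Set ι}
    (hS : IsElementary U E S) (hT : T.Countable) {h : ι → Set ℕ}
    (hh : ∀ K : Finset ι, (K : Set ι) ⊆ S → IsTrace U E h K) :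
    ∃ h' : ι → Set ℕ, (∀ i ∈ S, h' i = h i) ∧
      ∀ K : Finset ι, (K : Set ι) ⊆ T → IsTrace U E h' K := by
  classical
  obtain ⟨K, hK, hKT, hTK⟩ := exists_exhaustion hT
  let Γ := {G : Finset ι // (G : Set ι) ⊆ S}
  have step (n : ℕ) (G : Γ) := hS.exists_crossing ((K n).filter (· ∈ S) ∪ G.1) (K n) (by
    intro i hi
    rcases Finset.mem_union.1 (Finset.mem_coe.1 hi) with hi | hi
    · exact (Finset.mem_filter.1 hi).2
    · exact G.2 hi)
  choose M τ hM hfix hmem hcopy w hw using step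
  let next (n : ℕ) (G : Γ) : Γ := ⟨(M n G).image (τ n G), by
    intro i hi
    obtain ⟨j, hj, rfl⟩ := Finset.mem_image.1 (Finset.mem_coe.1 hi)
    exact hmem n G j hj⟩
  let G : ℕ → Γ := fun n => Nat.rec ⟨∅, by simp⟩ next n
  have hKM : ∀ n, K n ⊆ M n (G n) := fun n =>
    Finset.subset_union_right.trans (hM n (G n))
  have htr : ∀ n, IsTrace (U ∘ τ n (G n)) E (h ∘ τ n (G n)) (M n (G n)) := fun n =>
    (hh _ (next n (G n)).2).image
  choose y hy using fun n => (htr n).walk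
  choose z hz using fun n k => (hcopy n (G n)).back (y n k)
  have hhz : ∀ n, ∀ᶠ k in atTop, ∀ i ∈ M n (G n), k ∈ h (τ n (G n) i) ↔ z n k ∈ U i := by
    intro n
    filter_upwards [hy n] with k hk i hi
    exact (hk.1 i hi).trans (hz n k i hi)
  obtain ⟨x, hx1, hx2, hx3⟩ := exists_spliced_of_crossing hE hK z
    (fun n k => ∀ i ∈ K n, k ∈ h (τ n (G n) i) ↔ z n k ∈ U i)
    (fun n => (hhz n).mono fun k hk i hi => hk i (hKM n hi))
    (fun n => (hy n).mono fun k hk => ((hcopy n (G n)).edge _ _ _ _ (hz n k) (hz n (k + 1))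
      hk.2).anti hE (hKM n))
    (fun n x => by
      obtain ⟨x', hx'⟩ := (hcopy n (G n)).forth x
      refine (((htr n).visit x').and_eventually (hhz n)).mono fun k hk i hi => ?_
      have hi := hKM n hi
      exact (hk.2 i hi).symm.trans ((hk.1 i hi).trans (hx' i hi)))
    -- Copy `n + 1` fixes `τ n (G n) i`, and `w n (G n)` does not separate this index from `i`. So
    -- whenever trace `n + 1` shows the pattern of `w n (G n)`, both walks are in its `K n`-cell.
    (fun n => by
      obtain ⟨x', hx'⟩ := (hcopy (n + 1) (G (n + 1))).forth (w n (G n))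
      refine (((htr (n + 1)).visit x').and_eventually
        ((hhz n).and (hhz (n + 1)))).mono fun k hk i hi => ?_
      have hi' : i ∈ M (n + 1) (G (n + 1)) := hKM (n + 1) (hK n.le_succ hi)
      have h1 : τ n (G n) i ∈ (G (n + 1)).1 := Finset.mem_image_of_mem _ (hKM n hi)
      have h2 := Finset.mem_union_right ((K (n + 1)).filter (· ∈ S)) h1
      have h3 := hM (n + 1) (G (n + 1)) (Finset.mem_union_left _ h2)
      have h4 := hk.1 _ h3
      have h5 := hx' _ h3
      simp only [Function.comp_apply, hfix (n + 1) (G (n + 1)) _ h2] at h4 h5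
      rw [← hk.2.2 i hi', ← hk.2.1 i (hKM n hi), h4, h5, hw n (G n) i hi, ← hx' i hi']
      exact hk.1 i hi')
  -- On `S` the old sets stay; they eventually agree with the walk because copy `j` fixes `K j ∩ S`.
  refine ⟨fun i => if i ∈ S then h i else {k | x k ∈ U i}, fun i hi => if_pos hi, fun F hF => ?_⟩
  obtain ⟨n, hn⟩ := exists_le_of_subset hK hTK F hF
  have hpat : ∀ᶠ k in atTop, ∀ i ∈ F,
      (k ∈ if i ∈ S then h i else {k | x k ∈ U i}) ↔ x k ∈ U i := by
    filter_upwards [hx3 n] with k hk i hi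
    obtain ⟨j, hj, hxz, hP⟩ := hk
    by_cases hiS : i ∈ S
    · have hij := hK hj (hn hi)
      rw [if_pos hiS, hxz, ← hP i hij, hfix j (G j) i
        (Finset.mem_union_left _ (Finset.mem_filter.2 ⟨hij, hiS⟩))]
    · rw [if_neg hiS]
      rfl
  refine ⟨⟨x, hpat.and ((hx1 n).mono fun k hk => hk.anti hE hn)⟩, fun x' => ?_⟩
  exact ((hx2 n x').and_eventually hpat).mono fun k hk i hi =>
    (hk.2 i hi).trans (hk.1 i (hn hi))

end Splicing

/-! ### Finitary closure of index sets -/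

section Hull

variable {ι : Type v}

/-- The least set that contains `D` and, with each finite subset `F`, the set `W F`. -/
def hull (W : Finset ι → Set ι) (D : Set ι) : Set ι :=
  ⋂₀ {S | D ⊆ S ∧ ∀ F : Finset ι, (F : Set ι) ⊆ S → W F ⊆ S}

variable {W : Finset ι → Set ι}

theorem subset_hull (D : Set ι) : D ⊆ hull W D := fun _ hi _ hS => hS.1 hi

theorem hull_closed (D : Set ι) (F : Finset ι) (hF : (F : Set ι) ⊆ hull W D) :
    W F ⊆ hull W D := fun _ hi S hS => hS.2 F (fun _ hj => hF hj S hS) hi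

theorem hull_subset {D S : Set ι} (hD : D ⊆ S)
    (hS : ∀ F : Finset ι, (F : Set ι) ⊆ S → W F ⊆ S) : hull W D ⊆ S :=
  Set.sInter_subset_of_mem ⟨hD, hS⟩

theorem hull_mono {D D' : Set ι} (h : D ⊆ D') : hull W D ⊆ hull W D' :=
  hull_subset (h.trans (subset_hull D')) (hull_closed D')

theorem exists_subset_of_directed {κ : Type*} [Nonempty κ] {C : κ → Set ι}
    (hC : Directed (· ⊆ ·) C) (F : Finset ι) (hF : (F : Set ι) ⊆ ⋃ k, C k) :
    ∃ k, (F : Set ι) ⊆ C k := hC.exists_mem_subset_of_finset_subset_biUnion hF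

/-- Each closing condition concerns a finite set, which lies in a single member of a directed union.
Chains in the Zorn argument need this. -/
theorem hull_iUnion {κ : Type*} [Nonempty κ] {D : κ → Set ι} (hD : Directed (· ⊆ ·) D) :
    hull W (⋃ k, D k) = ⋃ k, hull W (D k) := by
  have hdir : Directed (· ⊆ ·) fun k => hull W (D k) := fun a b =>
    (hD a b).imp fun c hc => ⟨hull_mono hc.1, hull_mono hc.2⟩
  refine (hull_subset (Set.iUnion_mono fun k => subset_hull _) fun F hF => ?_).antisymm
    (Set.iUnion_subset fun k => hull_mono (Set.subset_iUnion D k))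
  obtain ⟨k, hk⟩ := exists_subset_of_directed hdir F hF
  exact (hull_closed _ F hk).trans (Set.subset_iUnion (fun k => hull W (D k)) k)

theorem countable_hull (hW : ∀ F, (W F).Countable) {D : Set ι} (hD : D.Countable) :
    (hull W D).Countable := by
  classical
  let next (C : Set ι) : Set ι := C ∪ ⋃ F ∈ {F : Finset ι | (F : Set ι) ⊆ C}, W F
  let C : ℕ → Set ι := fun n => next^[n] D
  have hsucc : ∀ n, C (n + 1) = next (C n) := fun n => Function.iterate_succ_apply' next n D
  have hmono : Monotone C := monotone_nat_of_le_succ fun n => by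
    rw [hsucc]
    exact Set.subset_union_left
  have hcount : ∀ n, (C n).Countable := by
    intro n
    induction n with
    | zero => exact hD
    | succ n ih =>
      rw [hsucc]
      refine ih.union (Set.Countable.biUnion ?_ fun F _ => hW F)
      refine (Set.countable_ofPred_finite_subset ih).preimage_of_injOn
        (f := fun F : Finset ι => (F : Set ι)) Finset.coe_injective.injOn |>.mono ?_
      exact fun F hF => ⟨F.finite_toSet, hF⟩
  refine (Set.countable_iUnion hcount).mono (hull_subset (Set.subset_iUnion C 0) fun F hF => ?_)
  obtain ⟨n, hn⟩ := exists_subset_of_directed hmono.directed_le F hF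
  refine Set.Subset.trans ?_ (Set.subset_iUnion C (n + 1))
  rw [hsucc]
  exact (Set.subset_biUnion_of_mem (u := W) (show F ∈ {F : Finset ι | (F : Set ι) ⊆ C n} from hn)
    ).trans Set.subset_union_right

end Hull

/-! ### Elementary sets, and traces on at most `ℵ₁` indices -/

section Chain

variable {X : Type u} {ι : Type v} (U : ι → Set X) (E : Set X → Set X → Prop)

/-- The patterns that the tuple `u` of indices realizes, and the edges between them. -/
def tupleType {J : Type*} (u : J → ι) : (Set J → Prop) × (Set J → Set J → Prop) :=
  (fun ε => ∃ x, ∀ j, x ∈ U (u j) ↔ j ∈ ε,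
    fun ε δ => E {x | ∀ j, x ∈ U (u j) ↔ j ∈ ε} {x | ∀ j, x ∈ U (u j) ↔ j ∈ δ})

variable {U E}

theorem isCopy_of_tupleType_eq {J : Type*} {u : J → ι} {K : Finset ι}
    (hK : ∀ i, i ∈ K ↔ i ∈ Set.range u) {τ : ι → ι}
    (h : tupleType U E (τ ∘ u) = tupleType U E u) : IsCopy U E K τ := by
  have h1 : ∀ ε : Set J, (∃ x, ∀ j, x ∈ U (τ (u j)) ↔ j ∈ ε) ↔ ∃ x, ∀ j, x ∈ U (u j) ↔ j ∈ ε :=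
    fun ε => iff_of_eq (congrFun (congrArg Prod.fst h) ε)
  have hu : ∀ j, u j ∈ K := fun j => (hK _).2 ⟨j, rfl⟩
  constructor
  · intro x
    obtain ⟨x', hx'⟩ := (h1 {j | x ∈ U (u j)}).2 ⟨x, fun j => Iff.rfl⟩
    refine ⟨x', fun i hi => ?_⟩
    obtain ⟨j, rfl⟩ := (hK i).1 hi
    exact hx' j
  · intro x'
    obtain ⟨x, hx⟩ := (h1 {j | x' ∈ U (τ (u j))}).1 ⟨x', fun j => Iff.rfl⟩
    refine ⟨x, fun i hi => ?_⟩
    obtain ⟨j, rfl⟩ := (hK i).1 hi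
    exact (hx j).symm
  · intro x y x' y' hx hy hxy
    have h2 := congrFun (congrFun (congrArg Prod.snd h) {j | x ∈ U (u j)}) {j | y ∈ U (u j)}
    have hc : ∀ z, cell U K z = {w | ∀ j, w ∈ U (u j) ↔ j ∈ {j | z ∈ U (u j)}} := by
      intro z
      ext w
      refine ⟨fun hw j => hw _ (hu j), fun hw i hi => ?_⟩
      obtain ⟨j, rfl⟩ := (hK i).1 hi
      exact hw j
    have hc' : ∀ z z', (∀ i ∈ K, z' ∈ U (τ i) ↔ z ∈ U i) → cell (U ∘ τ) K z' =
        {w | ∀ j, w ∈ U ((τ ∘ u) j) ↔ j ∈ {j | z ∈ U (u j)}} := by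
      intro z z' hz
      ext w
      refine ⟨fun hw j => (hw _ (hu j)).trans (hz _ (hu j)), fun hw i hi => ?_⟩
      obtain ⟨j, rfl⟩ := (hK i).1 hi
      exact (hw j).trans (hz _ hi).symm
    rw [Edge, hc, hc]
    rw [Edge, hc' x x' hx, hc' y y' hy] at hxy
    exact h2.mp hxy

/-- Löwenheim–Skolem: over a finite `F`, tuples of a given length have finitely many types, so one
witness per type keeps `W F` countable. -/
theorem exists_isElementary_closure [DecidableEq ι] (U : ι → Set X)
    (E : Set X → Set X → Prop) :
    ∃ W : Finset ι → Set ι, (∀ F, (W F).Countable) ∧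
      ∀ S : Set ι, (∀ F : Finset ι, (F : Set ι) ⊆ S → W F ⊆ S) → IsElementary U E S := by
  let tp (F : Finset ι) (n : ℕ) (w : Fin n → ι) := tupleType U E (Sum.elim ((↑) : F → ι) w)
  let W (F : Finset ι) : Set ι := ⋃ n : ℕ, ⋃ t : Set.range (tp F n), Set.range t.2.choose
  refine ⟨W, fun F => ?_, fun S hS F K hF => ?_⟩
  · refine Set.countable_iUnion fun n => ?_
    have : Countable (Set.range (tp F n)) := by
      have : Finite (Set (F ⊕ Fin n) → Set (F ⊕ Fin n) → Prop) := Pi.finite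
      exact Finite.to_countable
    exact Set.countable_iUnion fun t => Set.countable_range _
  · obtain ⟨n, ⟨e⟩⟩ := Finite.exists_equiv_fin (K \ F : Finset ι)
    let t : Set.range (tp F n) := ⟨_, fun m => ((e.symm m : (K \ F : Finset ι)) : ι), rfl⟩
    let w := t.2.choose
    have hw : tp F n w = tp F n fun m => (e.symm m : (K \ F : Finset ι)) := t.2.choose_spec
    have hwS : ∀ m, w m ∈ S := fun m => hS F hF
      (Set.mem_iUnion.2 ⟨n, Set.mem_iUnion.2 ⟨t, m, rfl⟩⟩)
    let τ (i : ι) : ι := if h : i ∈ K \ F then w (e ⟨i, h⟩) else i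
    have hτF : ∀ i ∈ F, τ i = i := fun i hi => dif_neg fun h => (Finset.mem_sdiff.1 h).2 hi
    have hτK : ∀ i (h : i ∈ K \ F), τ i = w (e ⟨i, h⟩) := fun i h => dif_pos h
    refine ⟨τ, hτF, fun i hi => ?_, ?_⟩
    · by_cases h : i ∈ F
      · rw [hτF i h]
        exact hF h
      · rw [hτK i (Finset.mem_sdiff.2 ⟨hi, h⟩)]
        exact hwS _
    · refine isCopy_of_tupleType_eq
        (u := Sum.elim ((↑) : F → ι) fun m => ((e.symm m : (K \ F : Finset ι)) : ι)) (fun i => ?_) ?_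
      · rw [Set.Sum.elim_range, Set.mem_union, ← Finset.union_sdiff_self_eq_union,
          Finset.mem_union]
        refine or_congr (by simp) ⟨fun h => ⟨e ⟨i, h⟩, by simp⟩, ?_⟩
        rintro ⟨m, rfl⟩
        exact (e.symm m).2
      · have : τ ∘ Sum.elim ((↑) : F → ι) (fun m => ((e.symm m : (K \ F : Finset ι)) : ι)) =
            Sum.elim (↑) w := by
          funext j
          rcases j with j | m
          · exact hτF _ j.2
          · simp only [Function.comp_apply, Sum.elim_inr]
            rw [hτK _ (e.symm m).2]
            simp
        rw [this]
        exact hw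

theorem exists_path_of_transGen {r : X → X → Prop} {x y : X} (h : Relation.TransGen r x y) :
    ∃ (m : ℕ) (g : ℕ → X), 0 < m ∧ g 0 = x ∧ g m = y ∧ ∀ k < m, r (g k) (g (k + 1)) := by
  induction h with
  | single h =>
    rename_i b
    refine ⟨1, fun k => if k = 0 then x else b, one_pos, rfl, rfl, fun k hk => ?_⟩
    obtain rfl : k = 0 := by omega
    simpa using h
  | tail _ h ih =>
    rename_i b c _
    obtain ⟨m, g, hm, h0, hgm, hg⟩ := ih
    refine ⟨m + 1, fun k => if k ≤ m then g k else c, by omega, by simpa using h0, by simp,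
      fun k hk => ?_⟩
    rcases (Nat.lt_succ_iff.1 hk).lt_or_eq with hk | rfl
    · simpa [hk.le, Nat.succ_le_of_lt hk] using hg k hk
    · simpa [hgm] using h

/-- Paths at ever finer levels join consecutive terms of a sequence in which representatives of all
cells recur infinitely often. -/
theorem exists_isTrace_of_countable [Nonempty X]
    (hE : ∀ a b a' b', a ⊆ a' → b ⊆ b' → E a b → E a' b')
    (hconn : ∀ (K : Finset ι) x y, Relation.TransGen (Edge U E K) x y) {T : Set ι}
    (hT : T.Countable) :
    ∃ h : ι → Set ℕ, ∀ K : Finset ι, (K : Set ι) ⊆ T → IsTrace U E h K := by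
  obtain ⟨K, hK, -, hTK⟩ := exists_exhaustion hT
  choose D hD using fun n => exists_finset_forall_mem_cell U (K n)
  obtain ⟨d, hd⟩ : ∃ d : ℕ → X, (⋃ n, (D n : Set X)) = Set.range d := by
    refine (Set.countable_iUnion fun n => (D n).countable_toSet).exists_eq_range ?_
    obtain ⟨x⟩ := ‹Nonempty X›
    obtain ⟨a, ha, -⟩ := hD 0 x
    exact ⟨a, Set.mem_iUnion.2 ⟨0, ha⟩⟩
  have hd' : ∀ n x, ∃ m, d m ∈ cell U (K n) x := by
    intro n x
    obtain ⟨a, ha, hax⟩ := hD n x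
    obtain ⟨m, rfl⟩ : a ∈ Set.range d := hd ▸ Set.mem_iUnion.2 ⟨n, ha⟩
    exact ⟨m, hax⟩
  -- Unpairing repeats each `d b` at all positions `Nat.pair b a`, hence infinitely often.
  let p : ℕ → X := fun j => d j.unpair.1
  choose m g hm hg0 hgm hg using fun j =>
    exists_path_of_transGen (hconn (K j) (p j) (p (j + 1)))
  let t : ℕ → ℕ := fun j => Nat.rec 0 (fun j s => s + m j) j
  have htsucc : ∀ j, t (j + 1) = t j + m j := fun _ => rfl
  have ht : StrictMono t := strictMono_nat_of_lt_succ fun j => by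
    rw [htsucc]
    exact Nat.lt_add_of_pos_right (hm j)
  obtain ⟨y, hyz, hy⟩ := exists_spliced (U := U) (E := E) ht K (fun j k => g j (k - t j))
    (fun j k h1 h2 => by
      have : k + 1 - t j = k - t j + 1 := by omega
      rw [this]
      refine hg j _ ?_
      rw [htsucc] at h2
      omega)
    (fun j => by
      have : t (j + 1) - t j = m j := by rw [htsucc]; omega
      rw [this, hgm, Nat.sub_self, hg0]
      exact mem_cell_self _ _)
  refine ⟨fun i => {k | y k ∈ U i}, fun F hF => ?_⟩
  obtain ⟨n, hn⟩ := exists_le_of_subset hK hTK F hF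
  refine ⟨⟨y, ?_⟩, fun x => frequently_atTop.2 fun a => ?_⟩
  · filter_upwards [eventually_exists_block ht n] with k hk
    obtain ⟨j, hj, h1, h2⟩ := hk
    exact ⟨fun i _ => Iff.rfl, (hy j k h1 h2).anti hE (hn.trans (hK hj))⟩
  · obtain ⟨b, hb⟩ := hd' n x
    have hj : a ≤ Nat.pair b a := Nat.right_le_pair b a
    refine ⟨t (Nat.pair b a), hj.trans ht.le_apply, fun i hi => ?_⟩
    have h1 := hyz (Nat.pair b a) _ le_rfl (ht (Nat.lt_succ_self _))
    rw [Nat.sub_self, hg0] at h1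
    simp only [p, Nat.unpair_pair] at h1
    rw [Set.mem_ofPred_eq, h1]
    exact hb i (hn hi)

theorem IsTrace.congr {h h' : ι → Set ℕ} {K : Finset ι} (hh : IsTrace U E h K)
    (heq : ∀ i ∈ K, h' i = h i) : IsTrace U E h' K := by
  obtain ⟨⟨y, hy⟩, hv⟩ := hh
  exact ⟨⟨y, hy.mono fun k hk => ⟨fun i hi => by rw [heq i hi, hk.1 i hi], hk.2⟩⟩,
    fun x => (hv x).mono fun k hk i hi => by rw [heq i hi, hk i hi]⟩

theorem exists_isWellOrder_countable_initial (hι : #ι ≤ ℵ₁) :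
    ∃ r : ι → ι → Prop, IsWellOrder ι r ∧ ∀ a, {b | r b a}.Countable := by
  obtain ⟨r, hr, h⟩ := Cardinal.exists_ord_eq ι
  refine ⟨r, hr, fun a => Cardinal.le_aleph0_iff_set_countable.1
    (Cardinal.lt_aleph_one_iff.1 ?_)⟩
  exact (Ordinal.card_typein (r := r) a).trans_lt
    ((Cardinal.card_typein_lt (r := r) a h).trans_le hι)

/-- Zorn's lemma for initial segments with a trace on their hull. If a maximal segment misses `a`,
it lies below `a`, and the trace extends to the countable hull of the segment up to `a`. -/
theorem exists_isTrace_of_card_le_aleph_one [Nonempty X]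
    (hE : ∀ a b a' b', a ⊆ a' → b ⊆ b' → E a b → E a' b')
    (hconn : ∀ (K : Finset ι) x y, Relation.TransGen (Edge U E K) x y) (hι : #ι ≤ ℵ₁) :
    ∃ h : ι → Set ℕ, ∀ K : Finset ι, IsTrace U E h K := by
  classical
  obtain ⟨W, hW, hWel⟩ := exists_isElementary_closure U E
  obtain ⟨r, hr, hcount⟩ := exists_isWellOrder_countable_initial hι
  have hel : ∀ D, IsElementary U E (hull W D) := fun D => hWel _ (hull_closed D)
  let Γ := {p : Set ι × (ι → Set ℕ) // (∀ b ∈ p.1, ∀ c, r c b → c ∈ p.1) ∧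
    ∀ K : Finset ι, (K : Set ι) ⊆ hull W p.1 → IsTrace U E p.2 K}
  -- Agreement on the whole hull lets the traces of a chain be glued.
  let R (p q : Γ) : Prop := p.1.1 ⊆ q.1.1 ∧ ∀ i ∈ hull W p.1.1, q.1.2 i = p.1.2 i
  have hRtrans : ∀ {a b c : Γ}, R a b → R b c → R a c := fun {a b c} hab hbc =>
    ⟨hab.1.trans hbc.1, fun i hi => (hbc.2 i (hull_mono hab.1 hi)).trans (hab.2 i hi)⟩
  obtain ⟨⟨⟨I, h⟩, hI, hh⟩, hmax⟩ : ∃ m : Γ, ∀ a, R m a → R a m := by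
    refine exists_maximal_of_chains_bounded (fun c hc => ?_) hRtrans
    rcases c.eq_empty_or_nonempty with rfl | hne
    · obtain ⟨h₀, hh₀⟩ := exists_isTrace_of_countable hE hconn
        (countable_hull hW Set.countable_empty)
      exact ⟨⟨(∅, h₀), by simp, hh₀⟩, by simp⟩
    have : Nonempty c := hne.to_subtype
    have htot : ∀ p q : c, R p q ∨ R q p := fun p q => by
      by_cases hpq : p = q
      · exact Or.inl ⟨hpq ▸ subset_rfl, fun i _ => by rw [hpq]⟩
      · exact hc p.2 q.2 (fun h => hpq (Subtype.ext h))
    have hdir : Directed (· ⊆ ·) fun p : c => p.1.1.1 := fun p q => by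
      rcases htot p q with h | h
      · exact ⟨q, h.1, subset_rfl⟩
      · exact ⟨p, subset_rfl, h.1⟩
    have hdir' : Directed (· ⊆ ·) fun p : c => hull W p.1.1.1 := fun p q =>
      (hdir p q).imp fun c hc => ⟨hull_mono hc.1, hull_mono hc.2⟩
    have hagree : ∀ p q : c, ∀ i, i ∈ hull W p.1.1.1 → i ∈ hull W q.1.1.1 →
        p.1.1.2 i = q.1.1.2 i := fun p q i hp hq => by
      rcases htot p q with h | h
      · exact (h.2 i hp).symm
      · exact h.2 i hq
    let h' (i : ι) : Set ℕ := if hi : ∃ p : c, i ∈ hull W p.1.1.1 then hi.choose.1.1.2 i else ∅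
    have hh' : ∀ p : c, ∀ i ∈ hull W p.1.1.1, h' i = p.1.1.2 i := fun p i hi => by
      have hex : ∃ p : c, i ∈ hull W p.1.1.1 := ⟨p, hi⟩
      exact (dif_pos hex).trans (hagree _ _ i hex.choose_spec hi)
    refine ⟨⟨(⋃ p : c, p.1.1.1, h'), fun b hb d hd => ?_, fun K hK => ?_⟩, fun p hp =>
      ⟨Set.subset_iUnion (fun p : c => p.1.1.1) ⟨p, hp⟩, hh' ⟨p, hp⟩⟩⟩
    · obtain ⟨p, hp⟩ := Set.mem_iUnion.1 hb
      exact Set.mem_iUnion.2 ⟨p, p.1.2.1 b hp d hd⟩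
    · simp only [hull_iUnion hdir] at hK
      obtain ⟨p, hp⟩ := exists_subset_of_directed hdir' K hK
      exact (p.1.2.2 K hp).congr fun i hi => hh' p i (hp hi)
  have huniv : ∀ a, a ∈ I := by
    intro a
    let J : Set ι := {b | r b a} ∪ {a}
    obtain ⟨h', hh'1, hh'2⟩ := (hel I).exists_extension hE
      (countable_hull hW ((hcount a).union (Set.countable_singleton a))) hh
    by_contra ha
    have hIJ : I ⊆ J := fun b hb => by
      rcases trichotomous_of r b a with hba | rfl | hab
      · exact Or.inl hba
      · exact absurd hb ha
      · exact absurd (hI b hb a hab) ha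
    refine ha ((hmax ⟨(J, h'), ?_, hh'2⟩ ⟨hIJ, hh'1⟩).1 (Or.inr rfl))
    rintro b (hb | rfl) d hd
    · exact Or.inl (_root_.trans hd hb)
    · exact Or.inl hd
  exact ⟨h, fun K => hh K fun i _ => subset_hull I (huniv i)⟩

end Chain
-- From traces to quotient maps, and the converse
section Topology

theorem mem_remainder_iff {p : Ultrafilter ℕ} :
    p ∉ Set.range (pure : ℕ → Ultrafilter ℕ) ↔ (p : Filter ℕ) ≤ cofinite := by
  constructor
  · intro hp s hs
    by_contra h
    obtain ⟨x, -, hx⟩ := Ultrafilter.eq_pure_of_finite_mem (mem_cofinite.1 hs)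
      (Ultrafilter.compl_mem_iff_notMem.2 h)
    exact hp ⟨x, hx.symm⟩
  · rintro hp ⟨n, rfl⟩
    have h : ({n}ᶜ : Set ℕ) ∈ (pure n : Ultrafilter ℕ) :=
      hp (Set.finite_singleton n).compl_mem_cofinite
    exact h rfl

theorem Remainder.le_atTop (p : Remainder) : (p.1 : Filter ℕ) ≤ atTop := by
  rw [← Nat.cofinite_eq_atTop]
  exact mem_remainder_iff.1 p.2

theorem isOpen_setOf_mem (A : Set ℕ) : IsOpen {p : Remainder | A ∈ p.1} :=
  (ultrafilter_isOpen_basic A).preimage continuous_subtype_val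

instance : CompactSpace Remainder := by
  refine isCompact_iff_compactSpace.1 (IsClosed.isCompact ?_)
  have : {p : Ultrafilter ℕ | p ∉ Set.range (pure : ℕ → Ultrafilter ℕ)} =
      ⋂ n, {p : Ultrafilter ℕ | ({n}ᶜ : Set ℕ) ∈ p} := by
    ext p
    simp only [Set.mem_ofPred_eq, Set.mem_iInter]
    refine ⟨fun h n => mem_remainder_iff.1 h (Set.finite_singleton n).compl_mem_cofinite, ?_⟩
    rintro h ⟨n, rfl⟩
    exact h n rfl
  change IsClosed {p : Ultrafilter ℕ | p ∉ Set.range (pure : ℕ → Ultrafilter ℕ)}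
  rw [this]
  exact isClosed_iInter fun n => ultrafilter_isClosed_basic _

theorem exists_mem_remainder {A : Set ℕ} (hA : A.Infinite) : ∃ p : Remainder, A ∈ p.1 := by
  have : NeBot (cofinite ⊓ 𝓟 A) := cofinite_inf_principal_neBot_iff.2 hA
  refine ⟨⟨Ultrafilter.of (cofinite ⊓ 𝓟 A), mem_remainder_iff.2 ?_⟩, ?_⟩
  · exact (Ultrafilter.of_le _).trans inf_le_left
  · exact (Ultrafilter.of_le _) (mem_inf_of_right (mem_principal_self A))

theorem exists_mem_setOf_mem_subset {O : Set Remainder} (hO : IsOpen O) {p : Remainder}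
    (hp : p ∈ O) : ∃ A : Set ℕ, A ∈ p.1 ∧ {q : Remainder | A ∈ q.1} ⊆ O := by
  obtain ⟨O', hO', rfl⟩ := isOpen_induced_iff.1 hO
  obtain ⟨_, ⟨A, rfl⟩, hpA, hA⟩ := ultrafilterBasis_is_basis.exists_subset_of_mem_open hp hO'
  exact ⟨A, hpA, fun q hq => hA hq⟩

theorem exists_clopen_between {C O : Set Remainder} (hC : IsClosed C) (hO : IsOpen O)
    (hCO : C ⊆ O) :
    ∃ A : Set ℕ, C ⊆ {p : Remainder | A ∈ p.1} ∧ {p : Remainder | A ∈ p.1} ⊆ O := by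
  refine hC.isCompact.induction_on (p := fun s => ∃ A : Set ℕ,
    s ⊆ {p : Remainder | A ∈ p.1} ∧ {p : Remainder | A ∈ p.1} ⊆ O) ?_ ?_ ?_ ?_
  · exact ⟨∅, Set.empty_subset _, fun p hp => absurd hp (p.1.empty_notMem)⟩
  · rintro s t hst ⟨A, h1, h2⟩
    exact ⟨A, hst.trans h1, h2⟩
  · rintro s t ⟨A, h1, h2⟩ ⟨B, h3, h4⟩
    refine ⟨A ∪ B, Set.union_subset (fun p hp => mem_of_superset (h1 hp) Set.subset_union_left)
      fun p hp => mem_of_superset (h3 hp) Set.subset_union_right, fun p hp => ?_⟩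
    rcases Ultrafilter.union_mem_iff.1 hp with h | h
    · exact h2 h
    · exact h4 h
  · intro p hp
    obtain ⟨A, hpA, hA⟩ := exists_mem_setOf_mem_subset hO (hCO hp)
    exact ⟨_, mem_nhdsWithin_of_mem_nhds ((isOpen_setOf_mem A).mem_nhds hpA), A, subset_rfl, hA⟩

theorem continuous_shift : Continuous shift := by
  refine Continuous.subtype_mk ?_ _
  refine Continuous.comp (g := shiftBeta) ?_ continuous_subtype_val
  exact ultrafilterBasis_is_basis.continuous_iff.2 (by
    rintro _ ⟨A, rfl⟩
    exact ultrafilter_isOpen_basic ((fun n => n + 1) ⁻¹' A))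

/-- If `f '' closure U ⊆ U`, a clopen set given by some `A` fits between `shift '' (Q ⁻¹' closure
U)` and `Q ⁻¹' U`, so the shift maps it into itself. Then `A` is almost closed under successor,
hence finite or cofinite, and `U` is empty or everything. -/
theorem weaklyIncompressible_of_isQuotientOf {X : Type u} [TopologicalSpace X] {f : X → X}
    (h : IsQuotientOf f shift) : WeaklyIncompressible f := by
  obtain ⟨Q, hQ, hsurj, hcomm⟩ := h
  intro U hU hne hnu hfU
  have hmap : ∀ p, Q p ∈ closure U → Q (shift p) ∈ U := fun p hp => by
    have : Q (shift p) = f (Q p) := congrFun hcomm p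
    rw [this]
    exact hfU ⟨_, hp, rfl⟩
  have hC : IsClosed (shift '' (Q ⁻¹' closure U)) :=
    ((isClosed_closure.preimage hQ).isCompact.image continuous_shift).isClosed
  obtain ⟨A, hA1, hA2⟩ := exists_clopen_between hC (hU.preimage hQ) (by
    rintro _ ⟨p, hp, rfl⟩
    exact hmap p hp)
  have hstep : ∀ p : Remainder, A ∈ p.1 → A ∈ (shift p).1 := fun p hp =>
    hA1 ⟨p, subset_closure (hA2 hp), rfl⟩
  have hfin : {k | k ∈ A ∧ k + 1 ∉ A}.Finite := by
    by_contra h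
    obtain ⟨p, hp⟩ := exists_mem_remainder h
    have h1 : (fun n => n + 1) ⁻¹' A ∈ p.1 := hstep p (mem_of_superset hp fun k hk => hk.1)
    obtain ⟨k, hk1, hk2⟩ := p.1.nonempty_of_mem (inter_mem hp h1)
    exact hk1.2 hk2
  obtain ⟨N, hN⟩ := hfin.bddAbove
  have hN' : ∀ k, N < k → k ∈ A → k + 1 ∈ A := fun k hk hkA => by
    by_contra h
    exact absurd (hN ⟨hkA, h⟩) (not_le.2 hk)
  by_cases hAfin : A.Finite
  · obtain ⟨x, hx⟩ := Set.nonempty_iff_ne_empty.2 hne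
    obtain ⟨p, rfl⟩ := hsurj x
    have h1 : A ∈ (shift p).1 := hA1 ⟨p, subset_closure hx, rfl⟩
    exact (Ultrafilter.compl_notMem_iff.2 h1)
      (mem_remainder_iff.1 (shift p).2 hAfin.compl_mem_cofinite)
  · obtain ⟨a, haA, ha⟩ := Set.Infinite.exists_gt hAfin N
    have hall : ∀ k, a ≤ k → k ∈ A := fun k hk =>
      Nat.le_induction haA (fun k hk ih => hN' k (ha.trans_le hk) ih) k hk
    refine hnu (Set.eq_univ_of_forall fun x => ?_)
    obtain ⟨p, rfl⟩ := hsurj x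
    exact hA2 (mem_of_superset (p.le_atTop (Ici_mem_atTop a)) hall)

/-- Let `a` be the set reachable from `x`. If `f` sent a point of `closure a` into `closure aᶜ`, an
edge would leave `a`. So `f '' closure a ⊆ interior a`, which forces `a` to be everything. -/
theorem transGen_edge_of_weaklyIncompressible {X : Type u} [TopologicalSpace X] {ι : Type v}
    (U : ι → Set X) {f : X → X} (hf : WeaklyIncompressible f) (K : Finset ι) (x y : X) :
    Relation.TransGen (Edge U (fun a b => (f '' closure a ∩ closure b).Nonempty) K) x y := by
  set r := Edge U (fun a b => (f '' closure a ∩ closure b).Nonempty) K with hr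
  let a : Set X := {y | Relation.TransGen r x y}
  have hstep : ∀ z, r z (f z) := fun z => ⟨f z,
    ⟨z, subset_closure (mem_cell_self K z), rfl⟩, subset_closure (mem_cell_self K (f z))⟩
  -- Closure commutes with the finite union of the cells that meet `b`.
  have hcl : ∀ b : Set X, ∀ z ∈ closure b, ∃ y ∈ b, z ∈ closure (cell U K y) := by
    intro b z hz
    obtain ⟨D, hD⟩ := exists_finset_forall_mem_cell U K
    classical
    have hsub : b ⊆ ⋃ d ∈ (D.filter fun d => ∃ y ∈ b, d ∈ cell U K y : Finset X), cell U K d := by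
      intro y hy
      obtain ⟨d, hd, hdy⟩ := hD y
      refine Set.mem_biUnion (Finset.mem_coe.2 (Finset.mem_filter.2 ⟨hd, y, hy, hdy⟩)) ?_
      rw [cell_eq_of_mem hdy]
      exact mem_cell_self K y
    have hz' := closure_mono hsub hz
    rw [Finset.closure_biUnion] at hz'
    obtain ⟨d, hd, hzd⟩ := Set.mem_iUnion₂.1 hz'
    obtain ⟨-, y, hy, hdy⟩ := Finset.mem_filter.1 hd
    exact ⟨y, hy, cell_eq_of_mem hdy ▸ hzd⟩
  by_contra hxy
  have key : f '' closure a ⊆ interior a := by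
    rintro _ ⟨z, hz, rfl⟩
    by_contra hfz
    rw [← Set.mem_compl_iff, ← closure_compl] at hfz
    obtain ⟨y₁, hy₁, hzy₁⟩ := hcl _ _ hz
    obtain ⟨y₂, hy₂, hzy₂⟩ := hcl _ _ hfz
    exact hy₂ (Relation.TransGen.tail hy₁ ⟨f z, ⟨z, hzy₁, rfl⟩, hzy₂⟩)
  refine hf (interior a) isOpen_interior ?_ ?_ ?_
  · exact Set.nonempty_iff_ne_empty.1
      ⟨_, key ⟨f x, subset_closure (Relation.TransGen.single (hstep x)), rfl⟩⟩
  · intro h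
    exact hxy (interior_subset (h ▸ Set.mem_univ y))
  · exact (Set.image_mono (closure_mono interior_subset)).trans key

theorem exists_basic_of_mem {X : Type u} [TopologicalSpace X] [RegularSpace X] {ι : Type v}
    {U : ι → Set X} (hU : TopologicalSpace.IsTopologicalBasis (Set.range U)) {x : X} {O : Set X}
    (hO : O ∈ 𝓝 x) : ∃ i, x ∈ U i ∧ closure (U i) ⊆ O := by
  obtain ⟨C, hC, hCc, hCO⟩ := exists_mem_nhds_isClosed_subset hO
  obtain ⟨_, ⟨i, rfl⟩, hx, hi⟩ := hU.mem_nhds_iff.1 hC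
  exact ⟨i, hx, (closure_minimal hi hCc).trans hCO⟩

/-- Compactness provides `Q p`, and `Q p ∈ U i → h i ∈ p.1 → Q p ∈ closure (U i)`; by regularity
this gives continuity. -/
theorem isQuotientOf_of_isTrace {X : Type u} [TopologicalSpace X] [CompactSpace X] [T2Space X]
    {ι : Type v} {U : ι → Set X} (hU : TopologicalSpace.IsTopologicalBasis (Set.range U))
    {f : X → X} (hf : Continuous f) {h : ι → Set ℕ}
    (hh : ∀ K : Finset ι, IsTrace U (fun a b => (f '' closure a ∩ closure b).Nonempty) h K) :
    IsQuotientOf f shift := by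
  classical
  have hpat : ∀ (p : Remainder) (K : Finset ι), ∃ x, ∀ i ∈ K, x ∈ U i ↔ h i ∈ p.1 := by
    intro p K
    obtain ⟨y, hy⟩ := (hh K).walk
    have h1 : ∀ᶠ k in (p.1 : Filter ℕ), ∀ i ∈ K, k ∈ h i ↔ h i ∈ p.1 := by
      refine (eventually_all_finset K).2 fun i _ => ?_
      by_cases hi : h i ∈ p.1
      · filter_upwards [hi] with k hk
        exact iff_of_true hk hi
      · filter_upwards [Ultrafilter.compl_mem_iff_notMem.2 hi] with k hk
        exact iff_of_false hk hi
    obtain ⟨k, hk1, hk2⟩ := (h1.and (hy.filter_mono p.le_atTop)).exists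
    exact ⟨y k, fun i hi => (hk2.1 i hi).symm.trans (hk1 i hi)⟩
  have hpoint : ∀ p : Remainder, ∃ x, ∀ K : Finset ι,
      x ∈ closure {x | ∀ i ∈ K, x ∈ U i ↔ h i ∈ p.1} := by
    intro p
    have := IsCompact.nonempty_iInter_of_directed_nonempty_isCompact_isClosed
      (fun K : Finset ι => closure {x | ∀ i ∈ K, x ∈ U i ↔ h i ∈ p.1})
      (fun K L => ⟨K ∪ L,
        closure_mono fun x hx i hi => hx i (Finset.mem_union_left _ hi),
        closure_mono fun x hx i hi => hx i (Finset.mem_union_right _ hi)⟩)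
      (fun K => Set.Nonempty.closure (hpat p K)) (fun K => isClosed_closure.isCompact)
      (fun K => isClosed_closure)
    obtain ⟨x, hx⟩ := this
    exact ⟨x, Set.mem_iInter.1 hx⟩
  choose Q hQ using hpoint
  have hQ1 : ∀ p i, h i ∈ p.1 → Q p ∈ closure (U i) := fun p i hi =>
    closure_mono (fun x hx => (hx i (Finset.mem_singleton_self i)).2 hi) (hQ p {i})
  have hQ2 : ∀ p i, Q p ∈ U i → h i ∈ p.1 := by
    intro p i hi
    obtain ⟨x, hx, hx'⟩ := mem_closure_iff.1 (hQ p {i}) _ (hU.isOpen ⟨i, rfl⟩) hi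
    exact (hx' i (Finset.mem_singleton_self i)).1 hx
  refine ⟨Q, continuous_iff_continuousAt.2 fun p O hO => ?_, fun x => ?_, funext fun p => ?_⟩
  · obtain ⟨i, hi, hiO⟩ := exists_basic_of_mem hU hO
    refine mem_map.2 ?_
    filter_upwards [(isOpen_setOf_mem (h i)).mem_nhds (hQ2 p i hi)] with q hq
    exact hiO (hQ1 q i hq)
  · let B : Finset ι → Set ℕ := fun K => {k | ∀ i ∈ K, k ∈ h i ↔ x ∈ U i}
    -- Each `B K` is infinite by `visit`, so some free ultrafilter contains them all.
    have : NeBot (cofinite ⊓ ⨅ K, 𝓟 (B K)) := by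
      rw [inf_iInf]
      refine iInf_neBot_of_directed (fun K L => ⟨K ∪ L, ?_, ?_⟩) fun K => ?_
      · exact inf_le_inf_left _ (principal_mono.2 fun k hk i hi =>
          hk i (Finset.mem_union_left _ hi))
      · exact inf_le_inf_left _ (principal_mono.2 fun k hk i hi =>
          hk i (Finset.mem_union_right _ hi))
      · exact cofinite_inf_principal_neBot_iff.2
          (Nat.frequently_atTop_iff_infinite.1 ((hh K).visit x))
    let p : Remainder := ⟨Ultrafilter.of (cofinite ⊓ ⨅ K, 𝓟 (B K)),
      mem_remainder_iff.2 ((Ultrafilter.of_le _).trans inf_le_left)⟩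
    have hp : ∀ i, x ∈ U i → h i ∈ p.1 := fun i hi => by
      have h1 : B {i} ∈ (Ultrafilter.of (cofinite ⊓ ⨅ K, 𝓟 (B K)) : Filter ℕ) :=
        (Ultrafilter.of_le _) (mem_inf_of_right
          (mem_iInf_of_mem {i} (mem_principal_self (B {i}))))
      exact mem_of_superset h1 fun k hk => (hk i (Finset.mem_singleton_self i)).2 hi
    refine ⟨p, ?_⟩
    by_contra hne
    obtain ⟨i, hi, hiO⟩ := exists_basic_of_mem hU (isOpen_compl_singleton.mem_nhds (Ne.symm hne))
    exact hiO (hQ1 p i (hp i hi)) rfl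
  · by_contra hne
    obtain ⟨O₁, O₂, hO₁, hO₂, h1, h2, hdisj⟩ := t2_separation hne
    obtain ⟨j, hj, hjO⟩ := exists_basic_of_mem hU (hO₁.mem_nhds h1)
    obtain ⟨i, hi, hiO⟩ := exists_basic_of_mem hU ((hO₂.preimage hf).mem_nhds h2)
    have hi' := hQ2 p i hi
    have hj' : (fun n => n + 1) ⁻¹' h j ∈ p.1 := hQ2 (shift p) j hj
    obtain ⟨y, hy⟩ := (hh {i, j}).walk
    -- Time `k` supplies the edge, time `k + 1` places `y (k + 1)` in `U j`.
    have hy' := hy.and ((tendsto_add_atTop_nat 1).eventually hy)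
    obtain ⟨k, ⟨hk1, hk2⟩, hk3, hk4⟩ := ((show ∀ᶠ k in (p.1 : Filter ℕ), k ∈ h i from hi').and
      (show ∀ᶠ k in (p.1 : Filter ℕ), k + 1 ∈ h j from hj')).and
        (hy'.filter_mono p.le_atTop) |>.exists
    have hyi : y k ∈ U i := (hk3.1 i (by simp)).1 hk1
    have hyj : y (k + 1) ∈ U j := (hk4.1 j (by simp)).1 hk2
    obtain ⟨_, ⟨z, hz, rfl⟩, hfz⟩ := hk3.2
    have hzi : z ∈ closure (U i) := closure_mono (fun w hw => (hw i (by simp)).2 hyi) hz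
    have hzj : f z ∈ closure (U j) := closure_mono (fun w hw => (hw j (by simp)).2 hyj) hfz
    exact Set.disjoint_left.1 hdisj (hjO hzj) (hiO hzi)

end Topology

end OmegaStar

theorem mainTheorem1 {X : Type u} [TopologicalSpace X] [CompactSpace X] [T2Space X] [Nonempty X]
    (hX : OmegaStar.weight X ≤ ℵ₁) (f : X → X) (hf : Continuous f) :
    OmegaStar.IsQuotientOf f OmegaStar.shift ↔ OmegaStar.WeaklyIncompressible f := by
  refine ⟨OmegaStar.weaklyIncompressible_of_isQuotientOf, fun hwi => ?_⟩
  obtain ⟨B, hB, hcard⟩ : OmegaStar.weight X ∈ {κ : Cardinal.{u} |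
      ∃ B : Set (Set X), TopologicalSpace.IsTopologicalBasis B ∧ #B = κ} :=
    csInf_mem ⟨_, _, TopologicalSpace.isTopologicalBasis_opens, rfl⟩
  obtain ⟨h, hh⟩ := OmegaStar.exists_isTrace_of_card_le_aleph_one (U := ((↑) : B → Set X))
    (E := fun a b => (f '' closure a ∩ closure b).Nonempty)
    (fun a b a' b' ha hb hab => hab.mono
      (Set.inter_subset_inter (Set.image_mono (closure_mono ha)) (closure_mono hb)))
    (OmegaStar.transGen_edge_of_weaklyIncompressible _ hwi) (hcard.trans_le hX)
  exact OmegaStar.isQuotientOf_of_isTrace (by rwa [Subtype.range_coe]) hf hh
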